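/- Let $\mathbb K$ be $\mathbb R$ or $\mathbb C$. For a nonzero Banach space $E$ over $\mathbb K$, let $E^*$ be its topological dual and let $$n(E)=\inf\{v(T) : T\in\mathcal L(E),\ \|T\|=1\}$$ be its numerical index, where $v(T)=\sup\{|x^*(Tx)| : x\in E,\ x^*\in E^*,\ \|x\|=\|x^*\|=x^*(x)=1\}$ is the numerical radius of the bounded linear operator $T$ on $E$. Say that $E$ has the approximation property if for every compact $K\subset E$ and every $\varepsilon>0$ there is a bounded finite-rank operator $T$ on $E$ with $\|Tx-x\|\le\varepsilon$ for all $x\in K$. Say that $E$ has the Radon–Nikodým property if for every finite measure space $(\Omega,\Sigma,\mu)$ and every countably additive $G:\Sigma\to E$ of bounded variation that vanishes on the $\mu$-null sets there is a Bochner integrable $g:\Omega\to E$ with $G(A)=\int_A g\,d\mu$ for all $A\in\Sigma$. Let $X$ and $Y$ be nonzero Banach spaces over $\mathbb K$, and let $X\hat\otimes_\varepsilon Y$ be their injective tensor product, that is, the completion of $X\otimes Y$ under the norm $$\Big\|\sum_{i=1}^n x_i\otimes y_i\Big\|_\varepsilon=\sup\Big\{\Big|\sum_{i=1}^n x^*(x_i)\,y^*(y_i)\Big|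 : x^*\in X^*,\ y^*\in Y^*,\ \|x^*\|\le 1,\ \|y^*\|\le 1\Big\}.$$ If $X^*$ or $Y^*$ has the approximation property, and $X$ or $Y$ has the Radon–Nikodým property, then $$n\big((X\hat\otimes_\varepsilon Y)^*\big)\le\min\{n(X^*),n(Y^*)\}.$$ -/

import Mathlib

open scoped TensorProduct

noncomputable section

namespace BanachIndex

section NumericalIndex

variable (𝕜 : Type*) [RCLike 𝕜] {E : Type*} [NormedAddCommGroup E] [NormedSpace 𝕜 E]

/-- The numerical range `V(T)` of a bounded operator `T` on `E`: all the scalars `x* (T x)` with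
`‖x‖ = 1`, `‖x*‖ = 1` and `x* x = 1`. -/
def numericalRange (T : E →L[𝕜] E) : Set 𝕜 :=
  {c | ∃ (x : E) (f : StrongDual 𝕜 E), ‖x‖ = 1 ∧ ‖f‖ = 1 ∧ f x = 1 ∧ c = f (T x)}

/-- The numerical radius `v(T)`. The set is bounded above by `‖T‖`, and it is nonempty as soon
as `E` is nonzero. -/
def numericalRadius (T : E →L[𝕜] E) : ℝ :=
  sSup {r | ∃ c ∈ numericalRange 𝕜 T, r = ‖c‖}

variable (E) in
/-- The numerical index `n(E)`. The set is bounded below by `0`, and it is nonempty as soon as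
`E` is nonzero. -/
def numericalIndex : ℝ :=
  sInf {r | ∃ T : E →L[𝕜] E, ‖T‖ = 1 ∧ r = numericalRadius 𝕜 T}

end NumericalIndex

/-- The approximation property: the identity is approximated, uniformly on every compact set, by
bounded operators of finite rank. -/
def HasApproximationProperty (𝕜 : Type*) [RCLike 𝕜] (E : Type*) [NormedAddCommGroup E]
    [NormedSpace 𝕜 E] : Prop :=
  ∀ K : Set E, IsCompact K → ∀ ε : ℝ, 0 < ε →
    ∃ T : E →L[𝕜] E, FiniteDimensional 𝕜 (LinearMap.range T.toLinearMap) ∧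
      ∀ x ∈ K, ‖T x - x‖ ≤ ε

open MeasureTheory in
/-- The Radon-Nikodym property: for every finite measure space `(Ω, μ)`, every countably additive
`E`-valued measure of bounded variation that vanishes on the `μ`-null sets has a Bochner
integrable density with respect to `μ`. The Bochner integral is that of the underlying real Banach
space. As the property is determined by Lebesgue measure on the unit interval, it does not matter
in which universe the spaces `Ω` are taken. -/
def HasRadonNikodymProperty (𝕜 : Type*) [RCLike 𝕜] (E : Type*) [NormedAddCommGroup E]
    [NormedSpace 𝕜 E] : Prop :=
  letI : NormedSpace ℝ E := NormedSpace.restrictScalars ℝ 𝕜 E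
  ∀ (Ω : Type) (_ : MeasurableSpace Ω) (μ : Measure Ω), IsFiniteMeasure μ →
    ∀ G : VectorMeasure Ω E, G.variation Set.univ < ⊤ →
      (∀ A, MeasurableSet A → μ A = 0 → G A = 0) →
      ∃ g : Ω → E, Integrable g μ ∧ ∀ A, MeasurableSet A → G A = ∫ ω in A, g ω ∂μ

section InjectiveTensor

variable (𝕜 : Type*) [RCLike 𝕜] (X Y : Type*)
  [NormedAddCommGroup X] [NormedSpace 𝕜 X] [NormedAddCommGroup Y] [NormedSpace 𝕜 Y]

variable {𝕜 X Y} in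
/-- The functional `x* ⊗ y*` on `X ⊗ Y`: it sends `∑ i, x i ⊗ y i` to `∑ i, x* (x i) * y* (y i)`. -/
def tensorFunctional (f : StrongDual 𝕜 X) (g : StrongDual 𝕜 Y) : X ⊗[𝕜] Y →ₗ[𝕜] 𝕜 :=
  TensorProduct.dualDistrib 𝕜 X Y (f.toLinearMap ⊗ₜ[𝕜] g.toLinearMap)

/-- The values whose supremum is the injective norm of `u`. -/
def injectiveValues (u : X ⊗[𝕜] Y) : Set ℝ :=
  {r | ∃ (f : StrongDual 𝕜 X) (g : StrongDual 𝕜 Y), ‖f‖ ≤ 1 ∧ ‖g‖ ≤ 1 ∧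
    r = ‖tensorFunctional f g u‖}

theorem injectiveValues_nonempty (u : X ⊗[𝕜] Y) : (injectiveValues 𝕜 X Y u).Nonempty :=
  ⟨_, 0, 0, by simp, by simp, rfl⟩

theorem injectiveValues_bddAbove (u : X ⊗[𝕜] Y) : BddAbove (injectiveValues 𝕜 X Y u) := by
  induction u using TensorProduct.induction_on with
  | zero =>
    refine ⟨0, ?_⟩
    rintro r ⟨f, g, -, -, rfl⟩
    simp
  | tmul x y =>
    refine ⟨‖x‖ * ‖y‖, ?_⟩
    rintro r ⟨f, g, hf, hg, rfl⟩
    have h1 : ‖f x‖ ≤ ‖x‖ := by simpa using f.le_of_opNorm_le hf x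
    have h2 : ‖g y‖ ≤ ‖y‖ := by simpa using g.le_of_opNorm_le hg y
    simpa [tensorFunctional] using mul_le_mul h1 h2 (norm_nonneg _) (norm_nonneg _)
  | add u v hu hv =>
    obtain ⟨a, ha⟩ := hu
    obtain ⟨b, hb⟩ := hv
    refine ⟨a + b, ?_⟩
    rintro r ⟨f, g, hf, hg, rfl⟩
    rw [map_add]
    exact (norm_add_le _ _).trans (add_le_add (ha ⟨f, g, hf, hg, rfl⟩) (hb ⟨f, g, hf, hg, rfl⟩))

/-- The injective norm on the algebraic tensor product `X ⊗ Y`, as a seminorm. -/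
def injectiveSeminorm : Seminorm 𝕜 (X ⊗[𝕜] Y) :=
  Seminorm.ofSMulLE (fun u => sSup (injectiveValues 𝕜 X Y u))
    (le_antisymm
      (csSup_le (injectiveValues_nonempty 𝕜 X Y 0) (by rintro r ⟨f, g, -, -, rfl⟩; simp))
      (le_csSup (injectiveValues_bddAbove 𝕜 X Y 0) ⟨0, 0, by simp, by simp, by simp⟩))
    (by
      intro u v
      refine csSup_le (injectiveValues_nonempty 𝕜 X Y _) ?_
      rintro r ⟨f, g, hf, hg, rfl⟩
      rw [map_add]
      exact (norm_add_le _ _).trans (add_le_add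
        (le_csSup (injectiveValues_bddAbove 𝕜 X Y u) ⟨f, g, hf, hg, rfl⟩)
        (le_csSup (injectiveValues_bddAbove 𝕜 X Y v) ⟨f, g, hf, hg, rfl⟩)))
    (by
      intro c u
      refine csSup_le (injectiveValues_nonempty 𝕜 X Y _) ?_
      rintro r ⟨f, g, hf, hg, rfl⟩
      rw [map_smul, norm_smul]
      exact mul_le_mul_of_nonneg_left
        (le_csSup (injectiveValues_bddAbove 𝕜 X Y u) ⟨f, g, hf, hg, rfl⟩) (norm_nonneg c))

/-- A copy of the algebraic tensor product `X ⊗ Y`, to carry the injective norm. -/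
def AlgInjectiveTensor : Type _ := X ⊗[𝕜] Y

instance : AddCommGroup (AlgInjectiveTensor 𝕜 X Y) := inferInstanceAs (AddCommGroup (X ⊗[𝕜] Y))

instance : Module 𝕜 (AlgInjectiveTensor 𝕜 X Y) := inferInstanceAs (Module 𝕜 (X ⊗[𝕜] Y))

instance : SeminormedAddCommGroup (AlgInjectiveTensor 𝕜 X Y) :=
  AddGroupSeminorm.toSeminormedAddCommGroup
    (E := AlgInjectiveTensor 𝕜 X Y) (injectiveSeminorm 𝕜 X Y).toAddGroupSeminorm

instance : NormedSpace 𝕜 (AlgInjectiveTensor 𝕜 X Y) where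
  norm_smul_le c u := (map_smul_eq_mul (injectiveSeminorm 𝕜 X Y) c u).le

/-- The injective tensor product of `X` and `Y`: the completion of `X ⊗ Y` under the injective
norm. -/
abbrev InjectiveTensorProduct : Type _ := UniformSpace.Completion (AlgInjectiveTensor 𝕜 X Y)

end InjectiveTensor

end BanachIndex

end

namespace BanachIndex

/-! ### Numerical radius, states and numerical index. -/

section NumericalIndex

variable {𝕜 : Type*} [RCLike 𝕜]
  {W : Type*} [NormedAddCommGroup W] [NormedSpace 𝕜 W]
  {Z : Type*} [NormedAddCommGroup Z] [NormedSpace 𝕜 Z]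

/-! A functional on `X ⊗ Y` bounded for the injective norm is an integral operator `S : X → Y*`, and
integral operators form an ideal: for `A` in `L(Y*)` the composition `A ∘ S` gives again such a
functional, of norm at most `‖A‖` times the old one. So `L(Y*)` acts on the dual of `X ⊗ Y`,
linearly and unitally, and isometrically since functionals `f ⊗ h` recover `A h`
(`norm_dualActionLM`).

A unital isometric embedding `Λ` of `L(W)` into `L(Z)` forces `n(Z) ≤ n(W)`: a pair `(z, f)` in the
definition of `v(Λ T)` induces the state `A ↦ f (Λ A z)` of `L(W)`, and states at `T` never exceed
`v(T)`, by Lumer's estimate. Hence `v(Λ T) ≤ v(T)` while `‖Λ T‖ = ‖T‖`. Exchanging the factors gives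
the bound by `n(X*)`.

The ideal property (`norm_sum_operator_sliceDual_le`) is proved without integral representations: a
finite net of functionals replaces the injective norm by a finite `ℓ∞`-norm, whose dual is an
`ℓ1`-sum on which `A` acts coordinatewise. -/

theorem norm_le_numericalRadius (T : W →L[𝕜] W) {c : 𝕜} (hc : c ∈ numericalRange 𝕜 T) :
    ‖c‖ ≤ numericalRadius 𝕜 T := by
  refine le_csSup ⟨‖T‖, ?_⟩ ⟨c, hc, rfl⟩
  rintro r ⟨c, ⟨x, f, hx, hf, -, rfl⟩, rfl⟩
  calc ‖f (T x)‖ ≤ ‖f‖ * (‖T‖ * ‖x‖) := f.le_opNorm_of_le (T.le_opNorm x)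
    _ = ‖T‖ := by rw [hx, hf, one_mul, mul_one]

theorem numericalRadius_nonneg (T : W →L[𝕜] W) : 0 ≤ numericalRadius 𝕜 T := by
  refine Real.sSup_nonneg ?_
  rintro r ⟨c, -, rfl⟩
  exact norm_nonneg c

/-- If `f` is a norming functional of `x`, then `|f (T x)| ≤ v(T) ‖x‖`. -/
theorem norm_apply_le_numericalRadius_mul (T : W →L[𝕜] W) {x : W} {f : StrongDual 𝕜 W}
    (hf : ‖f‖ = 1) (hfx : f x = (‖x‖ : 𝕜)) : ‖f (T x)‖ ≤ numericalRadius 𝕜 T * ‖x‖ := by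
  rcases eq_or_ne x 0 with rfl | hx
  · simp
  have hx' : ‖x‖ ≠ 0 := norm_ne_zero_iff.2 hx
  have hx'' : (‖x‖ : 𝕜) ≠ 0 := by exact_mod_cast hx'
  have h := norm_le_numericalRadius (𝕜 := 𝕜) T (c := f (T ((‖x‖ : 𝕜)⁻¹ • x)))
    ⟨_, f, by rw [norm_smul, norm_inv, RCLike.norm_ofReal, abs_norm, inv_mul_cancel₀ hx'], hf,
      by rw [map_smul, hfx, smul_eq_mul, inv_mul_cancel₀ hx''], rfl⟩
  rw [map_smul, map_smul, norm_smul, norm_inv, RCLike.norm_ofReal, abs_norm] at h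
  rwa [inv_mul_le_iff₀ (by positivity), mul_comm] at h

/-- Lumer's lower estimate for `1 - T`. -/
theorem one_sub_numericalRadius_mul_norm_le (T : W →L[𝕜] W) (x : W) (a : 𝕜) :
    (1 - ‖a‖ * numericalRadius 𝕜 T) * ‖x‖ ≤ ‖x - a • T x‖ := by
  rcases eq_or_ne x 0 with rfl | hx
  · simp
  obtain ⟨f, hf, hfx⟩ := exists_dual_vector 𝕜 x (norm_ne_zero_iff.2 hx)
  have h1 : ‖f (x - a • T x)‖ ≤ ‖x - a • T x‖ := by simpa [hf] using f.le_opNorm (x - a • T x)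
  have h2 : ‖x‖ - ‖a‖ * ‖f (T x)‖ ≤ ‖f (x - a • T x)‖ := by
    rw [map_sub, map_smul, hfx]
    simpa [norm_smul] using norm_sub_norm_le (‖x‖ : 𝕜) (a • f (T x))
  have h3 := mul_le_mul_of_nonneg_left (norm_apply_le_numericalRadius_mul T hf hfx) (norm_nonneg a)
  linarith

/-- Lumer's estimate at the vector `(1 + aT) y`, where `(1 - aT)(1 + aT) = 1 - a²T²` leaves only a
second-order error. -/
theorem norm_one_add_smul_le (T : W →L[𝕜] W) (a : 𝕜) :
    (1 - ‖a‖ * numericalRadius 𝕜 T) * ‖1 + a • T‖ ≤ 1 + ‖a‖ ^ 2 * ‖T‖ ^ 2 := by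
  rcases le_or_gt (1 - ‖a‖ * numericalRadius 𝕜 T) 0 with h | h
  · exact (mul_nonpos_of_nonpos_of_nonneg h (norm_nonneg _)).trans (by positivity)
  rw [mul_comm, ← le_div_iff₀ h]
  refine ContinuousLinearMap.opNorm_le_bound _ (by positivity) fun y => ?_
  rw [div_mul_eq_mul_div, le_div_iff₀ h, mul_comm]
  refine (one_sub_numericalRadius_mul_norm_le T _ a).trans ?_
  have h1 : (1 + a • T) y - a • T ((1 + a • T) y) = y - a • a • T (T y) := by
    simp only [add_apply, one_apply_eq_self,
      smul_apply, map_add, map_smul, smul_add]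
    abel
  rw [h1]
  calc ‖y - a • a • T (T y)‖ ≤ ‖y‖ + ‖a • a • T (T y)‖ := norm_sub_le _ _
    _ ≤ ‖y‖ + ‖a‖ * (‖a‖ * (‖T‖ * (‖T‖ * ‖y‖))) := by
      rw [norm_smul, norm_smul]
      gcongr
      exact T.le_opNorm_of_le (T.le_opNorm y)
    _ = (1 + ‖a‖ ^ 2 * ‖T‖ ^ 2) * ‖y‖ := by ring

/-- A state of the algebra of bounded operators is dominated by the numerical radius. -/
theorem norm_state_le_numericalRadius (s : (W →L[𝕜] W) →ₗ[𝕜] 𝕜) (hs : ∀ A, ‖s A‖ ≤ ‖A‖)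
    (hs1 : s 1 = 1) (T : W →L[𝕜] W) : ‖s T‖ ≤ numericalRadius 𝕜 T := by
  obtain ⟨w, hw, hwT⟩ := RCLike.exists_norm_eq_mul_self (s T)
  set m := numericalRadius 𝕜 T
  have hm : 0 ≤ m := numericalRadius_nonneg T
  set c := ‖s T‖ with hc
  have hc0 : 0 ≤ c := norm_nonneg _
  -- With `a = t w`, the phase `w` makes `s (1 + aT) = 1 + t c`, so `(1 - t m)(1 + t c) ≤ 1 + t²
  -- ‖T‖²`. The first-order terms give the claim as `t` tends to `0`.
  have key : ∀ t : ℝ, 0 < t → t * m ≤ 1 → c - m ≤ t * (‖T‖ ^ 2 + c * m) := by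
    intro t ht htm
    have h1 := norm_one_add_smul_le T ((t : 𝕜) * w)
    have hn : ‖(t : 𝕜) * w‖ = t := by
      rw [norm_mul, hw, mul_one, RCLike.norm_ofReal, abs_of_pos ht]
    rw [hn] at h1
    have h2 := hs (1 + ((t : 𝕜) * w) • T)
    have h3 : ‖s (1 + ((t : 𝕜) * w) • T)‖ = 1 + t * c := by
      rw [map_add, map_smul, hs1, smul_eq_mul, mul_assoc, ← hwT]
      have : (1 + (t : 𝕜) * (c : 𝕜)) = ((1 + t * c : ℝ) : 𝕜) := by push_cast; rfl
      rw [this, RCLike.norm_ofReal, abs_of_nonneg (by positivity)]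
    rw [h3] at h2
    have h4 := (mul_le_mul_of_nonneg_left h2 (sub_nonneg.2 htm)).trans h1
    have h5 : t * (c - m) ≤ t * (t * (‖T‖ ^ 2 + c * m)) := by linarith
    exact le_of_mul_le_mul_left h5 ht
  by_contra! hlt
  have hK : 0 < ‖T‖ ^ 2 + c * m + m + 1 := by positivity
  have hd : 0 < c - m := sub_pos.2 hlt
  -- This `t` is small enough for `t m ≤ 1` and for the right side of `key` to be at most `(c - m) /
  -- 2`.
  have h := key (min (c - m) 1 / (2 * (‖T‖ ^ 2 + c * m + m + 1))) (by positivity) (by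
    rw [div_mul_eq_mul_div, div_le_one (by positivity)]
    nlinarith [mul_le_mul_of_nonneg_right (min_le_right (c - m) 1) hm, sq_nonneg ‖T‖,
      mul_nonneg hc0 hm])
  rw [div_mul_eq_mul_div, le_div_iff₀ (by positivity)] at h
  nlinarith [mul_le_mul_of_nonneg_right (min_le_left (c - m) 1)
    (by positivity : 0 ≤ ‖T‖ ^ 2 + c * m), mul_nonneg hd.le (by positivity : 0 ≤ ‖T‖ ^ 2 + c * m),
    mul_nonneg hd.le hm]

/-- If `L(W)` embeds isometrically into `L(Z)` by a unital linear map, then `n(Z) ≤ n(W)`. -/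
theorem numericalIndex_le_of_unital_isometry [Nontrivial W] (Λ : (W →L[𝕜] W) →ₗ[𝕜] (Z →L[𝕜] Z))
    (hΛ : ∀ A, ‖Λ A‖ = ‖A‖) (hΛ1 : Λ 1 = 1) : numericalIndex 𝕜 Z ≤ numericalIndex 𝕜 W := by
  refine le_csInf ⟨_, 1, norm_one, rfl⟩ ?_
  rintro r ⟨T, hT, rfl⟩
  have hmem : numericalRadius 𝕜 (Λ T) ∈ {r | ∃ S : Z →L[𝕜] Z, ‖S‖ = 1 ∧ r = numericalRadius 𝕜 S} :=
    ⟨Λ T, by rw [hΛ, hT], rfl⟩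
  refine (csInf_le ⟨0, ?_⟩ hmem).trans ?_
  · rintro r ⟨S, -, rfl⟩
    exact numericalRadius_nonneg S
  refine Real.sSup_le ?_ (numericalRadius_nonneg T)
  rintro r ⟨c, ⟨z, f, hz, hf, hfz, rfl⟩, rfl⟩
  refine norm_state_le_numericalRadius
    (f.toLinearMap ∘ₗ (ContinuousLinearMap.apply 𝕜 Z z).toLinearMap ∘ₗ Λ) (fun A => ?_) ?_ T
  · calc ‖f (Λ A z)‖ ≤ ‖f‖ * (‖Λ A‖ * ‖z‖) := f.le_opNorm_of_le ((Λ A).le_opNorm z)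
      _ = ‖A‖ := by rw [hf, hz, hΛ, one_mul, mul_one]
  · simp [hΛ1, hfz]

end NumericalIndex

end BanachIndex

namespace BanachIndex

/-! ### Extension of functionals, and duals of finite sums and of completions. -/

section HahnBanach

variable {𝕜 : Type*} [RCLike 𝕜] {V : Type*} [AddCommGroup V] [Module 𝕜 V]
  {W : Type*} [NormedAddCommGroup W] [NormedSpace 𝕜 W]
  {E : Type*} [SeminormedAddCommGroup E] [NormedSpace 𝕜 E]
  {F : Type*} [SeminormedAddCommGroup F] [NormedSpace 𝕜 F]

/-- A functional bounded by `C ‖J v‖` factors through `J` with norm at most `C`. -/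
theorem exists_factor_of_norm_le (J : V →ₗ[𝕜] W) (φ : V →ₗ[𝕜] 𝕜) {C : ℝ} (hC : 0 ≤ C)
    (h : ∀ v, ‖φ v‖ ≤ C * ‖J v‖) : ∃ ψ : StrongDual 𝕜 W, ‖ψ‖ ≤ C ∧ ∀ v, ψ (J v) = φ v := by
  obtain ⟨ψ, hψ, hn⟩ := exists_extension_norm_eq (LinearMap.range J) (φ.compLeftInverse J)
  have hval : ∀ v, φ.compLeftInverse J ⟨J v, v, rfl⟩ = φ v := fun v =>
    LinearMap.compLeftInverse_apply_of_bdd φ J ⟨C, h⟩ v _ rfl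
  refine ⟨ψ, hn.trans_le (ContinuousLinearMap.opNorm_le_bound _ hC ?_), fun v => ?_⟩
  · rintro ⟨_, v, rfl⟩
    rw [hval]
    exact h v
  · rw [← hval, ← hψ]

/-- The dual of a finite `ℓ∞`-sum is the `ℓ1`-sum of the duals. -/
theorem sum_norm_comp_single_le {κ : Type*} [Fintype κ] [DecidableEq κ]
    (ψ : StrongDual 𝕜 (κ → W)) :
    ∑ k, ‖ψ ∘L ContinuousLinearMap.single 𝕜 (fun _ => W) k‖ ≤ ‖ψ‖ := by
  refine le_of_forall_pos_le_add fun ε hε => ?_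
  -- Each coordinate may lose `δ`, in total at most `ε`; the `+ 1` covers empty `κ`.
  have hδ : 0 < ε / (Fintype.card κ + 1) := by positivity
  set δ := ε / (Fintype.card κ + 1)
  have h : ∀ k, ∃ w : W, ‖w‖ ≤ 1 ∧ ∃ r : ℝ, ψ (Pi.single k w) = (r : 𝕜) ∧
      ‖ψ ∘L ContinuousLinearMap.single 𝕜 (fun _ => W) k‖ - δ ≤ r := by
    intro k
    obtain ⟨w, hw, hlt⟩ := ContinuousLinearMap.exists_lt_apply_of_lt_opNorm
      (ψ ∘L ContinuousLinearMap.single 𝕜 (fun _ => W) k) (sub_lt_self _ hδ)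
    obtain ⟨c, hc, hcw⟩ := RCLike.exists_norm_eq_mul_self
      ((ψ ∘L ContinuousLinearMap.single 𝕜 (fun _ => W) k) w)
    refine ⟨c • w, by rw [norm_smul, hc, one_mul]; exact hw.le, _, ?_, hlt.le⟩
    rw [hcw, ← smul_eq_mul, ← map_smul]
    rfl
  choose w hw r hr hle using h
  have h1 : ψ w = ((∑ k, r k : ℝ) : 𝕜) := by
    conv_lhs => rw [← Finset.univ_sum_single w]
    rw [map_sum]
    push_cast
    exact Finset.sum_congr rfl fun k _ => hr k
  have h2 : ∑ k, r k ≤ ‖ψ‖ := by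
    have h3 : ‖ψ w‖ ≤ ‖ψ‖ := by
      simpa using ψ.le_opNorm_of_le ((pi_norm_le_iff_of_nonneg zero_le_one).2 hw)
    rw [h1, RCLike.norm_ofReal] at h3
    exact (le_abs_self _).trans h3
  have h4 : ∑ k, ‖ψ ∘L ContinuousLinearMap.single 𝕜 (fun _ => W) k‖ ≤ ∑ k, (r k + δ) :=
    Finset.sum_le_sum fun k _ => by linarith [hle k]
  rw [Finset.sum_add_distrib, Finset.sum_const, Finset.card_univ, nsmul_eq_mul] at h4
  have h5 : (Fintype.card κ : ℝ) * δ ≤ ε := by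
    rw [mul_div_assoc', div_le_iff₀ (by positivity)]
    nlinarith
  linarith

theorem opNorm_le_of_conj (e : E ≃ₗᵢ[𝕜] F) {A : E →L[𝕜] E} {B : F →L[𝕜] F}
    (h : ∀ x, B x = e (A (e.symm x))) : ‖B‖ ≤ ‖A‖ := by
  refine ContinuousLinearMap.opNorm_le_bound _ (norm_nonneg _) fun x => ?_
  rw [h, e.norm_map]
  simpa using A.le_opNorm (e.symm x)

theorem norm_comp_linearIsometry (i : E →ₗᵢ[𝕜] F) (hi : DenseRange i) (φ : StrongDual 𝕜 F) :
    ‖φ ∘L i.toContinuousLinearMap‖ = ‖φ‖ := by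
  refine le_antisymm (ContinuousLinearMap.opNorm_le_bound _ (norm_nonneg _) fun x => ?_)
    (ContinuousLinearMap.opNorm_le_bound _ (norm_nonneg _) fun x => ?_)
  · simpa using φ.le_opNorm (i x)
  · refine hi.induction_on (p := fun x => ‖φ x‖ ≤ ‖φ ∘L i.toContinuousLinearMap‖ * ‖x‖) x
      (isClosed_le (by fun_prop) (by fun_prop)) fun y => ?_
    simpa using (φ ∘L i.toContinuousLinearMap).le_opNorm y

/-- Restriction of functionals to a dense isometric copy of a subspace. -/
theorem exists_dual_linearIsometryEquiv {F : Type*} [NormedAddCommGroup F] [NormedSpace 𝕜 F]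
    (i : E →ₗᵢ[𝕜] F) (hi : DenseRange i) :
    Nonempty (StrongDual 𝕜 F ≃ₗᵢ[𝕜] StrongDual 𝕜 E) := by
  let R : StrongDual 𝕜 F →ₗ[𝕜] StrongDual 𝕜 E :=
    { toFun := fun φ => φ ∘L i.toContinuousLinearMap
      map_add' := fun φ ψ => rfl
      map_smul' := fun c φ => rfl }
  have hR : ∀ φ, ‖R φ‖ = ‖φ‖ := norm_comp_linearIsometry i hi
  have hinj : Function.Injective R := (injective_iff_map_eq_zero R).2 fun φ hφ => by
    rw [← norm_eq_zero, ← hR, hφ, norm_zero]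
  refine ⟨{ LinearEquiv.ofBijective R ⟨hinj, fun ψ => ?_⟩ with norm_map' := hR }⟩
  refine ⟨ψ.toLinearMap.extendOfNorm i.toLinearMap, ?_⟩
  ext x
  exact LinearMap.extendOfNorm_eq (f := ψ.toLinearMap) (e := i.toLinearMap) hi
    ⟨‖ψ‖, fun x => by simpa using ψ.le_opNorm x⟩ x

end HahnBanach

/-! ### The injective norm on the algebraic tensor product. -/

section Tensor

variable {𝕜 : Type*} [RCLike 𝕜] {X Y : Type*}
  [NormedAddCommGroup X] [NormedSpace 𝕜 X] [NormedAddCommGroup Y] [NormedSpace 𝕜 Y]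

namespace AlgInjectiveTensor

variable (𝕜) in
/-- The elementary tensor `x ⊗ y`. -/
def tmul (x : X) (y : Y) : AlgInjectiveTensor 𝕜 X Y := x ⊗ₜ[𝕜] y

theorem norm_le {u : AlgInjectiveTensor 𝕜 X Y} {C : ℝ}
    (h : ∀ (f : StrongDual 𝕜 X) (g : StrongDual 𝕜 Y), ‖f‖ ≤ 1 → ‖g‖ ≤ 1 →
      ‖tensorFunctional f g u‖ ≤ C) : ‖u‖ ≤ C := by
  refine csSup_le (injectiveValues_nonempty 𝕜 X Y u) ?_
  rintro r ⟨f, g, hf, hg, rfl⟩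
  exact h f g hf hg

theorem norm_tensorFunctional_le_of_norm_le_one (u : AlgInjectiveTensor 𝕜 X Y)
    {f : StrongDual 𝕜 X} {g : StrongDual 𝕜 Y} (hf : ‖f‖ ≤ 1) (hg : ‖g‖ ≤ 1) :
    ‖tensorFunctional f g u‖ ≤ ‖u‖ :=
  le_csSup (injectiveValues_bddAbove 𝕜 X Y u) ⟨f, g, hf, hg, rfl⟩

theorem tensorFunctional_sum {ι : Type*} (s : Finset ι) (x : ι → X) (y : ι → Y)
    (f : StrongDual 𝕜 X) (g : StrongDual 𝕜 Y) :
    tensorFunctional f g (∑ i ∈ s, tmul 𝕜 (x i) (y i) : AlgInjectiveTensor 𝕜 X Y) =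
      g (∑ i ∈ s, f (x i) • y i) := by
  change tensorFunctional f g (∑ i ∈ s, x i ⊗ₜ[𝕜] y i : X ⊗[𝕜] Y) = _
  simp [tensorFunctional]

/-- The injective norm as the norm of an operator from `X*` to `Y`. -/
theorem norm_sum_smul_le {ι : Type*} (s : Finset ι) (x : ι → X) (y : ι → Y)
    {f : StrongDual 𝕜 X} (hf : ‖f‖ ≤ 1) :
    ‖∑ i ∈ s, f (x i) • y i‖ ≤ ‖∑ i ∈ s, tmul 𝕜 (x i) (y i)‖ := by
  obtain ⟨g, hg, hgy⟩ := exists_dual_vector'' 𝕜 (∑ i ∈ s, f (x i) • y i)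
  have h := norm_tensorFunctional_le_of_norm_le_one (∑ i ∈ s, tmul 𝕜 (x i) (y i)) hf hg
  rwa [tensorFunctional_sum, hgy, RCLike.norm_ofReal, abs_norm] at h

theorem norm_sum_tmul_le {ι : Type*} (s : Finset ι) (x : ι → X) (y : ι → Y) {C : ℝ}
    (h : ∀ f : StrongDual 𝕜 X, ‖f‖ ≤ 1 → ‖∑ i ∈ s, f (x i) • y i‖ ≤ C) :
    ‖∑ i ∈ s, tmul 𝕜 (x i) (y i)‖ ≤ C := by
  refine norm_le fun f g hf hg => ?_
  rw [tensorFunctional_sum]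
  exact (g.le_of_opNorm_le hg _).trans (by rw [one_mul]; exact h f hf)

theorem norm_tmul_le (x : X) (y : Y) : ‖tmul 𝕜 x y‖ ≤ ‖x‖ * ‖y‖ := by
  have h := norm_sum_tmul_le (𝕜 := 𝕜) {()} (fun _ => x) (fun _ => y) (C := ‖x‖ * ‖y‖)
    fun f hf => by
      rw [Finset.sum_singleton, norm_smul]
      gcongr
      simpa using f.le_of_opNorm_le hf x
  simpa using h

theorem norm_tensorFunctional_le (f : StrongDual 𝕜 X) (g : StrongDual 𝕜 Y)
    (u : AlgInjectiveTensor 𝕜 X Y) : ‖tensorFunctional f g u‖ ≤ ‖f‖ * ‖g‖ * ‖u‖ := by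
  obtain ⟨n, x, y, rfl⟩ : ∃ (n : ℕ) (x : Fin n → X) (y : Fin n → Y),
      u = ∑ i, tmul 𝕜 (x i) (y i) := TensorProduct.exists_sum_tmul_eq u
  rw [tensorFunctional_sum]
  rcases eq_or_ne f 0 with rfl | hf
  · simp
  have hf' : ‖f‖ ≠ 0 := norm_ne_zero_iff.2 hf
  have hn : ‖(‖f‖ : 𝕜)‖ = ‖f‖ := by simp
  have h := norm_sum_smul_le Finset.univ x y (f := (‖f‖ : 𝕜)⁻¹ • f)
    (by rw [norm_smul, norm_inv, hn, inv_mul_cancel₀ hf'])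
  simp only [smul_apply, smul_assoc, ← Finset.smul_sum, norm_smul, norm_inv, hn] at h
  rw [inv_mul_le_iff₀ (by positivity)] at h
  calc _ ≤ ‖g‖ * (‖f‖ * _) := g.le_opNorm_of_le h
    _ = _ := by ring

/-- The symmetry `X ⊗ Y → Y ⊗ X`. -/
def comm : AlgInjectiveTensor 𝕜 Y X →ₗᵢ[𝕜] AlgInjectiveTensor 𝕜 X Y where
  toLinearMap := (TensorProduct.comm 𝕜 Y X).toLinearMap
  norm_map' u := by
    have h : ∀ (f : StrongDual 𝕜 X) (g : StrongDual 𝕜 Y),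
        tensorFunctional f g (TensorProduct.comm 𝕜 Y X u) = tensorFunctional g f u := by
      intro f g
      refine LinearMap.congr_fun (f := tensorFunctional f g ∘ₗ (TensorProduct.comm 𝕜 Y X).toLinearMap)
        (TensorProduct.ext' fun y x => ?_) u
      simp [tensorFunctional, mul_comm]
    refine le_antisymm (norm_le fun f g hf hg => ?_) (norm_le fun g f hg hf => ?_)
    · exact (congrArg norm (h f g)).trans_le (norm_tensorFunctional_le_of_norm_le_one u hg hf)
    · rw [← h]
      exact norm_tensorFunctional_le_of_norm_le_one
        (TensorProduct.comm 𝕜 Y X u : AlgInjectiveTensor 𝕜 X Y) hf hg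

theorem comm_surjective : Function.Surjective (comm : AlgInjectiveTensor 𝕜 Y X → _) :=
  (TensorProduct.comm 𝕜 Y X).surjective

end AlgInjectiveTensor

end Tensor

end BanachIndex

namespace BanachIndex

/-! ### The action of `L(Y*)` on the dual of the injective tensor product. -/

section OperatorAction

variable {𝕜 : Type*} [RCLike 𝕜] {X Y : Type*}
  [NormedAddCommGroup X] [NormedSpace 𝕜 X] [NormedAddCommGroup Y] [NormedSpace 𝕜 Y]

/-- If `y ↦ ∑ S i (y i)` is bounded by the norm of finitely many linear combinations of the `y i`,
then so is `y ↦ ∑ A (S i) (y i)`, for every operator `A` on the dual. -/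
theorem norm_sum_operator_apply_le_of_matrix {ι M : Type*} [Fintype ι] [Fintype M]
    (a : M → ι → 𝕜) (S : ι → StrongDual 𝕜 Y) {C : ℝ} (hC : 0 ≤ C)
    (h : ∀ y : ι → Y, ‖∑ i, S i (y i)‖ ≤ C * ‖fun m => ∑ i, a m i • y i‖)
    (A : StrongDual 𝕜 Y →L[𝕜] StrongDual 𝕜 Y) (y : ι → Y) :
    ‖∑ i, A (S i) (y i)‖ ≤ ‖A‖ * C * ‖fun m => ∑ i, a m i • y i‖ := by
  classical
  let J : (ι → Y) →ₗ[𝕜] (M → Y) :=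
    LinearMap.pi fun m => ∑ i, a m i • LinearMap.proj i
  have hJ : ∀ y, J y = fun m => ∑ i, a m i • y i := fun y => by ext m; simp [J]
  -- The functional factors through the `ℓ∞`-sum over `M`; the components `H m` of `ψ` have norms
  -- summing to at most `C`, and each `S i` is a combination of them.
  obtain ⟨ψ, hψC, hψ⟩ := exists_factor_of_norm_le J
    (∑ i, (S i).toLinearMap ∘ₗ LinearMap.proj i) hC fun y => by simpa [hJ] using h y
  set H : M → StrongDual 𝕜 Y := fun m => ψ ∘L ContinuousLinearMap.single 𝕜 (fun _ => Y) m with hH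
  have hψH : ∀ w : M → Y, ψ w = ∑ m, H m (w m) := fun w => by
    conv_lhs => rw [← Finset.univ_sum_single w]
    rw [map_sum]
    rfl
  have hS : ∀ i, S i = ∑ m, a m i • H m := fun i => by
    ext z
    have h1 := hψ (Pi.single i z)
    have h2 : ∀ m, J (Pi.single i z) m = a m i • z := fun m => by
      rw [hJ]
      simp only [Pi.single_apply, smul_ite, smul_zero, Finset.sum_ite_eq', Finset.mem_univ, if_true]
    have h3 : ∑ j, S j ((Pi.single i z : ι → Y) j) = S i z := by
      rw [Finset.sum_eq_single i (fun j _ hj => by rw [Pi.single_eq_of_ne hj, map_zero])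
        (fun hi => absurd (Finset.mem_univ i) hi), Pi.single_eq_same]
    rw [hψH] at h1
    simp only [h2, map_smul] at h1
    simp only [LinearMap.sum_apply, LinearMap.comp_apply, LinearMap.proj_apply,
      ContinuousLinearMap.coe_coe, h3] at h1
    simpa using h1.symm
  have hsum : ∑ i, A (S i) (y i) = ∑ m, A (H m) (∑ i, a m i • y i) := by
    simp only [hS, map_sum, map_smul, sum_apply, smul_apply]
    exact Finset.sum_comm
  rw [hsum]
  calc ‖∑ m, A (H m) (∑ i, a m i • y i)‖
      ≤ ∑ m, ‖A‖ * ‖H m‖ * ‖fun m => ∑ i, a m i • y i‖ := by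
        refine norm_sum_le_of_le _ fun m _ => ((A (H m)).le_of_opNorm_le (A.le_opNorm _) _).trans ?_
        gcongr
        exact norm_le_pi_norm (fun m => ∑ i, a m i • y i) m
    _ = ‖A‖ * (∑ m, ‖H m‖) * ‖fun m => ∑ i, a m i • y i‖ := by
        rw [Finset.mul_sum, Finset.sum_mul]
    _ ≤ _ := by
        gcongr
        exact (sum_norm_comp_single_le ψ).trans hψC

/-- Finitely many functionals approximate all functionals of the unit ball on a finite set. -/
theorem exists_finite_net {ι : Type*} [Fintype ι] (x : ι → X) {δ : ℝ} (hδ : 0 < δ) :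
    ∃ t : Set (StrongDual 𝕜 X), t.Finite ∧ (∀ f ∈ t, ‖f‖ ≤ 1) ∧
      ∀ f : StrongDual 𝕜 X, ‖f‖ ≤ 1 → ∃ g ∈ t, ∀ i, ‖f (x i) - g (x i)‖ ≤ δ := by
  let ev : StrongDual 𝕜 X → ι → 𝕜 := fun f i => f (x i)
  have hb : TotallyBounded (ev '' Metric.closedBall 0 1) := by
    refine (isCompact_closedBall (0 : ι → 𝕜) ‖x‖).totallyBounded.subset ?_
    rintro _ ⟨f, hf, rfl⟩
    rw [mem_closedBall_zero_iff] at hf ⊢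
    refine (pi_norm_le_iff_of_nonneg (norm_nonneg x)).2 fun i => ?_
    exact (f.le_of_opNorm_le hf _).trans (by rw [one_mul]; exact norm_le_pi_norm x i)
  obtain ⟨t', ht', htf', hcov⟩ := Set.exists_subset_image_finite_and.1
    (Metric.finite_approx_of_totallyBounded hb δ hδ)
  refine ⟨t', htf', fun f hf => mem_closedBall_zero_iff.1 (ht' hf), fun f hf => ?_⟩
  have h := hcov ⟨f, mem_closedBall_zero_iff.2 hf, rfl⟩
  simp only [Set.mem_iUnion, Set.mem_image] at h
  obtain ⟨_, ⟨g, hg, rfl⟩, hfg⟩ := h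
  refine ⟨g, hg, fun i => ?_⟩
  rw [← dist_eq_norm]
  exact (dist_le_pi_dist (ev f) (ev g) i).trans (Metric.mem_ball.1 hfg).le

open AlgInjectiveTensor

/-- The operator `X → Y*` associated with a functional on `X ⊗ Y`. -/
noncomputable def sliceDual (Φ : StrongDual 𝕜 (AlgInjectiveTensor 𝕜 X Y)) : X →L[𝕜] StrongDual 𝕜 Y :=
  LinearMap.mkContinuous₂
    ((TensorProduct.mk 𝕜 X Y).compr₂ (show X ⊗[𝕜] Y →ₗ[𝕜] 𝕜 from Φ.toLinearMap)) ‖Φ‖ fun x y => by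
      rw [mul_assoc]
      exact Φ.le_opNorm_of_le (norm_tmul_le x y)

theorem sliceDual_apply (Φ : StrongDual 𝕜 (AlgInjectiveTensor 𝕜 X Y)) (x : X) (y : Y) :
    sliceDual Φ x y = Φ (tmul 𝕜 x y) := rfl

/-- The ideal property of integral operators. It makes `dualAction` well defined and contractive in
`A`. -/
theorem norm_sum_operator_sliceDual_le {ι : Type*} [Fintype ι]
    (A : StrongDual 𝕜 Y →L[𝕜] StrongDual 𝕜 Y) (Φ : StrongDual 𝕜 (AlgInjectiveTensor 𝕜 X Y))
    (x : ι → X) (y : ι → Y) :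
    ‖∑ i, A (sliceDual Φ (x i)) (y i)‖ ≤ ‖A‖ * ‖Φ‖ * ‖∑ i, tmul 𝕜 (x i) (y i)‖ := by
  classical
  have key : ∀ η : ℝ, 0 < η → ‖∑ i, A (sliceDual Φ (x i)) (y i)‖ ≤
      ‖A‖ * (‖Φ‖ * (1 + η)) * (‖∑ i, tmul 𝕜 (x i) (y i)‖ + η * ‖y‖) := by
    intro η hη
    -- The extra rows of `a` below give `η ‖z i‖ ≤ N`, so the net error `∑ δ ‖z i‖` is at most `card
    -- ι * δ * N / η ≤ η N`.
    have hδ : 0 < η ^ 2 / (Fintype.card ι + 1) := by positivity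
    set δ := η ^ 2 / (Fintype.card ι + 1)
    have hδη : Fintype.card ι * δ ≤ η * η := by
      rw [mul_div_assoc', div_le_iff₀ (by positivity)]
      nlinarith [sq_nonneg η]
    obtain ⟨t, htf, ht1, ht⟩ := exists_finite_net (𝕜 := 𝕜) x hδ
    have := htf.fintype
    -- The net rows approximate the injective norm; the rows `η • 1` control every `‖z i‖`, which
    -- the net alone need not do when the `x i` are dependent.
    let a : t ⊕ ι → ι → 𝕜 := Sum.elim (fun f i => (f : StrongDual 𝕜 X) (x i))
      (fun j i => if i = j then (η : 𝕜) else 0)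
    have ha : ∀ (z : ι → Y) (j : ι), ∑ i, a (Sum.inr j) i • z i = (η : 𝕜) • z j := fun z j => by
      simp [a]
    refine (norm_sum_operator_apply_le_of_matrix a (fun i => sliceDual Φ (x i))
      (C := ‖Φ‖ * (1 + η)) (by positivity) (fun z => ?_) A y).trans ?_
    · set N := ‖fun m => ∑ i, a m i • z i‖ with hN
      have hz : ∀ i, η * ‖z i‖ ≤ N := fun i => by
        have h := norm_le_pi_norm (fun m => ∑ i, a m i • z i) (Sum.inr i)
        rwa [ha, norm_smul, RCLike.norm_ofReal, abs_of_pos hη] at h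
      have hδz : ∑ i, δ * ‖z i‖ ≤ η * N := by
        have h1 : η * ∑ i, δ * ‖z i‖ ≤ η * (η * N) := by
          calc η * ∑ i, δ * ‖z i‖ = ∑ i, δ * (η * ‖z i‖) := by
                rw [Finset.mul_sum]
                exact Finset.sum_congr rfl fun i _ => by ring
            _ ≤ ∑ _i : ι, δ * N := Finset.sum_le_sum fun i _ => by
                have := hz i
                gcongr
            _ = Fintype.card ι * δ * N := by
                rw [Finset.sum_const, Finset.card_univ, nsmul_eq_mul]
                ring
            _ ≤ η * η * N := by gcongr
            _ = η * (η * N) := by ring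
        exact le_of_mul_le_mul_left h1 hη
      have hle : ‖∑ i, tmul 𝕜 (x i) (z i)‖ ≤ (1 + η) * N := by
        refine norm_sum_tmul_le _ _ _ fun f hf => ?_
        obtain ⟨g, hg, hfg⟩ := ht f hf
        have hsplit : ∑ i, f (x i) • z i =
            ∑ i, g (x i) • z i + ∑ i, (f (x i) - g (x i)) • z i := by
          rw [← Finset.sum_add_distrib]
          exact Finset.sum_congr rfl fun i _ => by rw [← add_smul, add_sub_cancel]
        have h1 : ‖∑ i, g (x i) • z i‖ ≤ N :=
          norm_le_pi_norm (fun m => ∑ i, a m i • z i) (Sum.inl ⟨g, hg⟩)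
        have h2 : ‖∑ i, (f (x i) - g (x i)) • z i‖ ≤ ∑ i, δ * ‖z i‖ :=
          norm_sum_le_of_le _ fun i _ => by
            rw [norm_smul]
            gcongr
            exact hfg i
        rw [hsplit]
        linarith [norm_add_le (∑ i, g (x i) • z i) (∑ i, (f (x i) - g (x i)) • z i)]
      simp only [sliceDual_apply, ← map_sum]
      rw [mul_assoc]
      exact Φ.le_opNorm_of_le hle
    · gcongr
      refine (pi_norm_le_iff_of_nonneg (by positivity)).2 ?_
      rintro (⟨f, hf⟩ | j)
      · exact (norm_sum_smul_le Finset.univ x y (ht1 f hf)).trans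
          (le_add_of_nonneg_right (by positivity))
      · rw [ha, norm_smul, RCLike.norm_ofReal, abs_of_pos hη]
        have := norm_le_pi_norm y j
        exact le_add_of_nonneg_of_le (norm_nonneg _) (by gcongr)
  have hlim : Filter.Tendsto (fun η : ℝ => ‖A‖ * (‖Φ‖ * (1 + η)) *
      (‖∑ i, tmul 𝕜 (x i) (y i)‖ + η * ‖y‖)) (nhdsWithin 0 (Set.Ioi 0))
      (nhds (‖A‖ * ‖Φ‖ * ‖∑ i, tmul 𝕜 (x i) (y i)‖)) := by
    refine tendsto_nhdsWithin_of_tendsto_nhds (Continuous.tendsto' (by fun_prop) _ _ (by simp))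
  exact ge_of_tendsto hlim (eventually_mem_nhdsWithin.mono fun η hη => key η hη)

/-- The action of `L(Y*)` on the dual of `X ⊗ Y`, by composition with the operators
`sliceDual Φ`. -/
noncomputable def dualAction (A : StrongDual 𝕜 Y →L[𝕜] StrongDual 𝕜 Y)
    (Φ : StrongDual 𝕜 (AlgInjectiveTensor 𝕜 X Y)) : StrongDual 𝕜 (AlgInjectiveTensor 𝕜 X Y) :=
  LinearMap.mkContinuous
    (show AlgInjectiveTensor 𝕜 X Y →ₗ[𝕜] 𝕜 from TensorProduct.lift
      (ContinuousLinearMap.coeLM 𝕜 ∘ₗ (A ∘L sliceDual Φ).toLinearMap)) (‖A‖ * ‖Φ‖) fun u => by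
    obtain ⟨n, x, y, rfl⟩ : ∃ (n : ℕ) (x : Fin n → X) (y : Fin n → Y),
        u = ∑ i, tmul 𝕜 (x i) (y i) := TensorProduct.exists_sum_tmul_eq u
    refine le_trans (le_of_eq ?_) (norm_sum_operator_sliceDual_le A Φ x y)
    rw [map_sum]
    rfl

theorem dualAction_tmul (A : StrongDual 𝕜 Y →L[𝕜] StrongDual 𝕜 Y)
    (Φ : StrongDual 𝕜 (AlgInjectiveTensor 𝕜 X Y)) (x : X) (y : Y) :
    dualAction A Φ (tmul 𝕜 x y) = A (sliceDual Φ x) y := rfl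

theorem norm_dualAction_le (A : StrongDual 𝕜 Y →L[𝕜] StrongDual 𝕜 Y)
    (Φ : StrongDual 𝕜 (AlgInjectiveTensor 𝕜 X Y)) : ‖dualAction A Φ‖ ≤ ‖A‖ * ‖Φ‖ :=
  LinearMap.mkContinuous_norm_le _ (by positivity) _

theorem dual_ext {Φ Ψ : StrongDual 𝕜 (AlgInjectiveTensor 𝕜 X Y)}
    (h : ∀ x y, Φ (tmul 𝕜 x y) = Ψ (tmul 𝕜 x y)) : Φ = Ψ := by
  ext u
  exact LinearMap.congr_fun (f := (show X ⊗[𝕜] Y →ₗ[𝕜] 𝕜 from Φ.toLinearMap))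
    (g := (show X ⊗[𝕜] Y →ₗ[𝕜] 𝕜 from Ψ.toLinearMap)) (TensorProduct.ext' h) u

theorem sliceDual_add (Φ Ψ : StrongDual 𝕜 (AlgInjectiveTensor 𝕜 X Y)) :
    sliceDual (Φ + Ψ) = sliceDual Φ + sliceDual Ψ := rfl

theorem sliceDual_smul (c : 𝕜) (Φ : StrongDual 𝕜 (AlgInjectiveTensor 𝕜 X Y)) :
    sliceDual (c • Φ) = c • sliceDual Φ := rfl

variable (𝕜 X Y) in
/-- `dualAction` as a linear map from `L(Y*)` to the operators on the dual of `X ⊗ Y`. -/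
noncomputable def dualActionLM : (StrongDual 𝕜 Y →L[𝕜] StrongDual 𝕜 Y) →ₗ[𝕜]
    (StrongDual 𝕜 (AlgInjectiveTensor 𝕜 X Y) →L[𝕜] StrongDual 𝕜 (AlgInjectiveTensor 𝕜 X Y)) where
  toFun A := LinearMap.mkContinuous
    { toFun := dualAction A
      map_add' := fun Φ Ψ => dual_ext fun x y => by
        simp only [dualAction_tmul, sliceDual_add, add_apply, map_add]
      map_smul' := fun c Φ => dual_ext fun x y => by
        simp only [dualAction_tmul, sliceDual_smul, smul_apply, map_smul, RingHom.id_apply] }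
    ‖A‖ (norm_dualAction_le A)
  map_add' A B := ContinuousLinearMap.ext fun Φ => dual_ext fun x y => rfl
  map_smul' c A := ContinuousLinearMap.ext fun Φ => dual_ext fun x y => rfl

theorem dualActionLM_apply (A : StrongDual 𝕜 Y →L[𝕜] StrongDual 𝕜 Y)
    (Φ : StrongDual 𝕜 (AlgInjectiveTensor 𝕜 X Y)) :
    dualActionLM 𝕜 X Y A Φ = dualAction A Φ := rfl

theorem dualActionLM_one : dualActionLM 𝕜 X Y 1 = 1 :=
  ContinuousLinearMap.ext fun _ => dual_ext fun _ _ => rfl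

theorem norm_dualActionLM [Nontrivial X] (A : StrongDual 𝕜 Y →L[𝕜] StrongDual 𝕜 Y) :
    ‖dualActionLM 𝕜 X Y A‖ = ‖A‖ := by
  refine le_antisymm
    (ContinuousLinearMap.opNorm_le_bound _ (norm_nonneg A) (norm_dualAction_le A)) ?_
  obtain ⟨x, hx⟩ := exists_ne (0 : X)
  obtain ⟨f, hf, hfx⟩ := exists_dual_vector 𝕜 x (norm_ne_zero_iff.2 hx)
  refine ContinuousLinearMap.opNorm_le_bound _ (ContinuousLinearMap.opNorm_nonneg _) fun h =>
    ContinuousLinearMap.opNorm_le_bound _ (mul_nonneg (ContinuousLinearMap.opNorm_nonneg _) (norm_nonneg h)) fun y => ?_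
  -- The functional `f ⊗ h` has slice `‖x‖ h` at `x`, so the action of `A` on it, tested on `x ⊗ y`,
  -- gives `‖x‖ (A h) y`.
  let Φ : StrongDual 𝕜 (AlgInjectiveTensor 𝕜 X Y) := LinearMap.mkContinuous
    (show AlgInjectiveTensor 𝕜 X Y →ₗ[𝕜] 𝕜 from tensorFunctional f h) (‖f‖ * ‖h‖)
    (norm_tensorFunctional_le f h)
  have hΦ : ‖Φ‖ ≤ ‖h‖ := by
    refine ContinuousLinearMap.opNorm_le_bound _ (norm_nonneg h) fun u => ?_
    have hu := norm_tensorFunctional_le f h u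
    rw [hf, one_mul] at hu
    exact hu
  have hs : sliceDual Φ x = (‖x‖ : 𝕜) • h := by
    ext z
    change tensorFunctional f h (x ⊗ₜ[𝕜] z) = _
    simp [tensorFunctional, hfx]
  have h1 : ‖dualActionLM 𝕜 X Y A Φ (tmul 𝕜 x y)‖ ≤
      ‖dualActionLM 𝕜 X Y A‖ * ‖h‖ * (‖x‖ * ‖y‖) := by
    refine (ContinuousLinearMap.le_of_opNorm_le_of_le _ ?_ (norm_tmul_le x y))
    exact (dualActionLM 𝕜 X Y A).le_opNorm_of_le hΦ
  rw [dualActionLM_apply, dualAction_tmul, hs, map_smul, smul_apply, norm_smul,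
    RCLike.norm_ofReal, abs_norm] at h1
  have hx0 : 0 < ‖x‖ := norm_pos_iff.2 hx
  refine le_of_mul_le_mul_left (h1.trans (le_of_eq ?_)) hx0
  ring

/-- The estimate `n(F*) ≤ n(Y*)` for a completion `F` of `X ⊗ Y` under the injective norm. It holds
for all nonzero `X` and `Y`, without the approximation or the Radon-Nikodym property. -/
theorem numericalIndex_dual_le_of_dense_isometry {F : Type*} [NormedAddCommGroup F]
    [NormedSpace 𝕜 F] [Nontrivial X] [Nontrivial Y] (i : AlgInjectiveTensor 𝕜 X Y →ₗᵢ[𝕜] F)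
    (hi : DenseRange i) :
    numericalIndex 𝕜 (StrongDual 𝕜 F) ≤ numericalIndex 𝕜 (StrongDual 𝕜 Y) := by
  obtain ⟨e⟩ := exists_dual_linearIsometryEquiv i hi
  have : Nontrivial (StrongDual 𝕜 Y) := inferInstance
  refine numericalIndex_le_of_unital_isometry
    { toFun := fun A => (e.symm.toContinuousLinearEquiv : _ →L[𝕜] StrongDual 𝕜 F) ∘L
        dualActionLM 𝕜 X Y A ∘L (e.toContinuousLinearEquiv : StrongDual 𝕜 F →L[𝕜] _)
      map_add' := fun A B => by ext1 φ; simp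
      map_smul' := fun c A => by ext1 φ; simp } (fun A => ?_) ?_
  · refine Eq.trans ?_ (norm_dualActionLM (X := X) A)
    exact le_antisymm (opNorm_le_of_conj e.symm fun φ => rfl)
      (opNorm_le_of_conj e fun Ψ => by simp [-ContinuousLinearEquiv.comp_coe])
  · ext1 φ
    simp [dualActionLM_one]

end OperatorAction

end BanachIndex

theorem mainTheorem11 {𝕜 : Type*} [RCLike 𝕜] {X Y : Type*}
    [NormedAddCommGroup X] [NormedSpace 𝕜 X] [CompleteSpace X] [Nontrivial X]
    [NormedAddCommGroup Y] [NormedSpace 𝕜 Y] [CompleteSpace Y] [Nontrivial Y]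
    (hAP : BanachIndex.HasApproximationProperty 𝕜 (StrongDual 𝕜 X) ∨
      BanachIndex.HasApproximationProperty 𝕜 (StrongDual 𝕜 Y))
    (hRNP : BanachIndex.HasRadonNikodymProperty 𝕜 X ∨
      BanachIndex.HasRadonNikodymProperty 𝕜 Y) :
    BanachIndex.numericalIndex 𝕜 (StrongDual 𝕜 (BanachIndex.InjectiveTensorProduct 𝕜 X Y)) ≤
      min (BanachIndex.numericalIndex 𝕜 (StrongDual 𝕜 X))
        (BanachIndex.numericalIndex 𝕜 (StrongDual 𝕜 Y)) := by
  have hdense : DenseRange (UniformSpace.Completion.toComplₗᵢ (𝕜 := 𝕜)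
      (E := BanachIndex.AlgInjectiveTensor 𝕜 X Y)) :=
    UniformSpace.Completion.denseRange_coe
  refine le_min ?_ (BanachIndex.numericalIndex_dual_le_of_dense_isometry _ hdense)
  -- For `X*`, the same completion is viewed as one of `Y ⊗ X`.
  refine BanachIndex.numericalIndex_dual_le_of_dense_isometry
    (UniformSpace.Completion.toComplₗᵢ.comp BanachIndex.AlgInjectiveTensor.comm) ?_
  exact hdense.comp BanachIndex.AlgInjectiveTensor.comm_surjective.denseRange
    (LinearIsometry.continuous _)
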